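/- For a probability mass function $p=(p_j)_{j\ge 1}$ on $\mathbb N=\{1,2,3,\dots\}$ let $H(p)=-\sum_{j}p_j\log p_j$ be its Shannon entropy (natural logarithm, $0\log 0=0$). For a constant $C$ let $$\mathcal P_C=\{p:\ p_j\le C\,j^{-2}\ \text{for all } j\ge 1\}$$ be the class of distributions with at least quadratically decaying tails. Fix $C>6/\pi^2$ (for $C\le 6/\pi^2$ this class has at most one element). Then the $L_2$-minimax risk for estimating the entropy from an i.i.d. sample $\mathbf X_n=(X^{(1)},\dots,X^{(n)})$ of $p$ satisfies $$\inf_{f}\ \sup_{p\in\mathcal P_C}\ \mathbb E_p\big[(f(\mathbf X_n)-H(p))^2\big]\ \asymp\ \frac1n ,$$ where the infimum is over all estimators $f:\mathbb N^n\to\mathbb R$; that is, there are constants $c,K>0$, depending only on $C$, such that for all $n\ge 1$ the left-hand side lies between $c/n$ and $K/n$. Moreover, the rate is attained by the harmonic estimator $$\hat H(\mathbf X_n)=\frac1n\sum_{i=1}^n\big[J(n-1)-J(m^{(i)}-1)\big],\qquad J(m)=\sum_{k=1}^m\frac1k,\quad m^{(i)}=\#\{k: X^{(k)}=X^{(i)}\},$$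 that is, $\sup_{p\in\mathcal P_C}\mathbb E_p[(\hat H(\mathbf X_n)-H(p))^2]\le K/n$ for all $n\ge1$. The same statements hold, with the same $c,K$, when $\mathcal P_C$ is replaced by its subclass of nonincreasing $p$ ($p_1\ge p_2\ge\cdots$). -/

import Mathlib

open MeasureTheory
open scoped ENNReal

/-- The positive integers carry the discrete σ-algebra. -/
instance instMeasurableSpacePNatDiscrete : MeasurableSpace ℕ+ := ⊤

instance instDiscreteMeasurableSpacePNat : DiscreteMeasurableSpace ℕ+ := ⟨fun _ => trivial⟩

/-- Shannon entropy (natural logarithm) of a probability mass function on the positive integers,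
`H(p) = -∑ p_j log p_j`, with `0 log 0 = 0`. -/
noncomputable def shannonEntropy (p : PMF ℕ+) : ℝ :=
  ∑' j : ℕ+, Real.negMulLog (p j).toReal

/-- The class of distributions on `{1, 2, 3, …}` with `p_j ≤ C j⁻²` for every `j`. -/
def quadraticTailClass (C : ℝ) : Set (PMF ℕ+) :=
  {p | ∀ j : ℕ+, (p j).toReal ≤ C / ((j : ℕ) : ℝ) ^ 2}

/-- The distributions with nonincreasing probabilities `p_1 ≥ p_2 ≥ …` in that class. -/
def decreasingQuadraticTailClass (C : ℝ) : Set (PMF ℕ+) :=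
  {p | p ∈ quadraticTailClass C ∧ Antitone (fun j : ℕ+ => p j)}

/-- On the class of quadratically decaying tails the entropy series converges, so that
`shannonEntropy` is the sum of a convergent series there. -/
theorem summable_negMulLog_of_mem_quadraticTailClass {C : ℝ} {p : PMF ℕ+}
    (hp : p ∈ quadraticTailClass C) :
    Summable (fun j : ℕ+ => Real.negMulLog (p j).toReal) := by
  have h0 : ∀ j : ℕ+, 0 ≤ (p j).toReal := fun j => ENNReal.toReal_nonneg
  have h1 : ∀ j : ℕ+, (p j).toReal ≤ 1 := fun j =>
    ENNReal.toReal_le_of_le_ofReal zero_le_one (by simpa using p.coe_le_one j)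
  have hC : 0 ≤ C := by
    have h := (h0 1).trans (hp 1)
    simpa using h
  have hs : Summable (fun j : ℕ+ => 4 * C ^ (3 / 4 : ℝ) * (1 / ((j : ℕ) : ℝ) ^ (3 / 2 : ℝ))) :=
    ((Real.summable_one_div_nat_rpow.mpr (by norm_num)).comp_injective
      PNat.coe_injective).mul_left _
  refine Summable.of_nonneg_of_le (fun j => Real.negMulLog_nonneg (h0 j) (h1 j)) (fun j => ?_) hs
  set x := (p j).toReal with hx
  have hj : (0 : ℝ) < ((j : ℕ) : ℝ) := by exact_mod_cast j.pos
  have hle : Real.negMulLog x ≤ 4 * x ^ (3 / 4 : ℝ) := by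
    rcases (h0 j).eq_or_lt with h | h
    · rw [← hx] at h
      rw [← h]
      simp
    · have hlog := Real.log_le_rpow_div (inv_nonneg.mpr h.le) (show (0 : ℝ) < 1 / 4 by norm_num)
      rw [Real.log_inv, Real.inv_rpow h.le, ← Real.rpow_neg h.le] at hlog
      have hm := mul_le_mul_of_nonneg_left hlog h.le
      have hpow : x * x ^ (-(1 / 4) : ℝ) = x ^ (3 / 4 : ℝ) := by
        nth_rewrite 1 [← Real.rpow_one x]
        rw [← Real.rpow_add h]
        norm_num
        rfl
      have he : x * (x ^ (-(1 / 4) : ℝ) / (1 / 4)) = 4 * x ^ (3 / 4 : ℝ) := by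
        rw [← hpow]; ring
      have hl : Real.negMulLog x = x * -Real.log x := by
        simp [Real.negMulLog]
      rw [hl, ← he]
      exact hm
  have hpw : x ^ (3 / 4 : ℝ) ≤ C ^ (3 / 4 : ℝ) * (1 / ((j : ℕ) : ℝ) ^ (3 / 2 : ℝ)) := by
    have h := Real.rpow_le_rpow (h0 j) (hp j) (show (0 : ℝ) ≤ 3 / 4 by norm_num)
    rw [Real.div_rpow hC (by positivity), ← Real.rpow_natCast, ← Real.rpow_mul hj.le] at h
    norm_num at h
    rw [mul_one_div]
    exact h
  calc Real.negMulLog x ≤ 4 * x ^ (3 / 4 : ℝ) := hle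
    _ ≤ 4 * (C ^ (3 / 4 : ℝ) * (1 / ((j : ℕ) : ℝ) ^ (3 / 2 : ℝ))) := by linarith
    _ = _ := by ring

/-- Mean squared error `E_p[(f(X⁽¹⁾, …, X⁽ⁿ⁾) - H(p))²]` of an estimator `f`, where the sample is
i.i.d. from `p`. Every subset of the countable sample space is measurable, so an estimator may be
any real function of the sample. -/
noncomputable def meanSquaredError {n : ℕ} (f : (Fin n → ℕ+) → ℝ) (p : PMF ℕ+) : ℝ≥0∞ :=
  ∫⁻ x, ENNReal.ofReal ((f x - shannonEntropy p) ^ 2) ∂(Measure.pi fun _ : Fin n => p.toMeasure)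

/-- Worst-case mean squared error of an estimator over a class of distributions. -/
noncomputable def worstCaseRisk (P : Set (PMF ℕ+)) {n : ℕ} (f : (Fin n → ℕ+) → ℝ) : ℝ≥0∞ :=
  ⨆ p ∈ P, meanSquaredError f p

/-- Minimax mean squared error for estimating the entropy from `n` i.i.d. samples. -/
noncomputable def minimaxRisk (P : Set (PMF ℕ+)) (n : ℕ) : ℝ≥0∞ :=
  ⨅ f : (Fin n → ℕ+) → ℝ, worstCaseRisk P f

/-- Number of occurrences of the `i`-th sample point in the sample. -/
def occurrences {n : ℕ} (x : Fin n → ℕ+) (i : Fin n) : ℕ :=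
  (Finset.univ.filter fun k => x k = x i).card

/-- The harmonic estimator `(1/n) ∑ᵢ (J(n-1) - J(m⁽ⁱ⁾ - 1))`, where `J` is the harmonic number
and `m⁽ⁱ⁾ ≥ 1` the number of occurrences of the `i`-th sample point. -/
noncomputable def harmonicEstimator (n : ℕ) (x : Fin n → ℕ+) : ℝ :=
  (1 / (n : ℝ)) * ∑ i : Fin n, ((harmonic (n - 1) : ℝ) - (harmonic (occurrences x i - 1) : ℝ))

/-! Upper bound. Put N = n - 1. Given X⁽ⁱ⁾ = a, the count m⁽ⁱ⁾ - 1 is binomial with parameters N and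
p_a, and the binomial mean of J(N) - J(K) is exactly the N-th partial sum of -log p = ∑ (1 - p)^k /
k (`binomialExpectation.harmonic_sub`). So H minus the mean of the estimator is ∑ p_j R(p_j), with R
the tail of that series. With v = n p, the product v R is at most a constant times min(1, v^(3/4)).
Since p_j ≤ C / j², the scale is r = √(C n): the terms n p_j R(p_j) are bounded for j up to r and
decay like (j / r)^(-3/2) beyond, so they sum to O(r) and the bias is O(√(C / n))
(`abs_shannonEntropy_sub_integral_le`).

The variance is bounded by `efron_stein`: deleting one observation changes n times the estimator by
that observation's own term and by at most one through all the others. The own term has a second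
moment bounded uniformly over the class, because it is controlled by ∑ p_j^(3/4) ≤ C^(3/4) ∑
j^(-3/2).

Lower bound. Moving mass t of order n^(-1/2) from point 2 to point 1 in the law (6/π²) j⁻² lowers
the entropy by at least t, while the χ² distance between the n-fold products stays bounded. Le Cam's
two-point argument (`le_meanSquaredError_add`) then forces a risk of order t². Both laws are
nonincreasing, so the bound already holds for the subclass. -/

/-! ### Binomial means of harmonic numbers -/

/-- Expectation of `F` under the binomial law with `N` trials and success probability `p`. -/
noncomputable def binomialExpectation (p : ℝ) : ℕ → (ℕ → ℝ) → ℝ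
  | 0, F => F 0
  | N + 1, F => p * binomialExpectation p N (fun k => F (k + 1)) +
      (1 - p) * binomialExpectation p N F

namespace binomialExpectation

theorem add (p : ℝ) (N : ℕ) (F G : ℕ → ℝ) :
    binomialExpectation p N (fun k => F k + G k) =
      binomialExpectation p N F + binomialExpectation p N G := by
  induction N generalizing F G with
  | zero => rfl
  | succ N ih =>
    simp only [binomialExpectation]
    rw [ih F G, ih (fun k => F (k + 1)) (fun k => G (k + 1))]
    ring

theorem const_mul (p : ℝ) (N : ℕ) (c : ℝ) (F : ℕ → ℝ) :
    binomialExpectation p N (fun k => c * F k) = c * binomialExpectation p N F := by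
  induction N generalizing F with
  | zero => rfl
  | succ N ih =>
    simp only [binomialExpectation]
    rw [ih F, ih (fun k => F (k + 1))]
    ring

theorem const (p : ℝ) (N : ℕ) (c : ℝ) : binomialExpectation p N (fun _ => c) = c := by
  induction N with
  | zero => rfl
  | succ N ih =>
    simp only [binomialExpectation]
    rw [ih]
    ring

theorem mono {p : ℝ} (h0 : 0 ≤ p) (h1 : p ≤ 1) {N : ℕ} {F G : ℕ → ℝ}
    (h : ∀ k ≤ N, F k ≤ G k) : binomialExpectation p N F ≤ binomialExpectation p N G := by
  induction N generalizing F G with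
  | zero => exact h 0 le_rfl
  | succ N ih =>
    simp only [binomialExpectation]
    have hq : 0 ≤ 1 - p := by linarith
    gcongr
    · exact ih fun k hk => h (k + 1) (by omega)
    · exact ih fun k hk => h k (by omega)

/-- Size biasing. -/
theorem natCast_mul (p : ℝ) (N : ℕ) (F : ℕ → ℝ) :
    binomialExpectation p (N + 1) (fun k => (k : ℝ) * F k) =
      (N + 1) * p * binomialExpectation p N (fun k => F (k + 1)) := by
  induction N generalizing F with
  | zero => simp [binomialExpectation]
  | succ N ih =>
    rw [binomialExpectation, ih F]
    have h1 : (fun k : ℕ => ((k + 1 : ℕ) : ℝ) * F (k + 1)) =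
        fun k : ℕ => (k : ℝ) * F (k + 1) + F (k + 1) := by
      funext k; push_cast; ring
    rw [h1, add, ih (fun k => F (k + 1))]
    simp only [binomialExpectation]
    push_cast
    ring

theorem indicator_zero (p : ℝ) (N : ℕ) :
    binomialExpectation p N (fun k => if k = 0 then 1 else 0) = (1 - p) ^ N := by
  induction N with
  | zero => simp [binomialExpectation]
  | succ N ih =>
    simp only [binomialExpectation, ih]
    simp only [Nat.add_eq_zero_iff, one_ne_zero, and_false, if_false, const]
    ring

/-- Size biasing applied to 1/k: since 0⁻¹ = 0, the product k · k⁻¹ is the indicator of k ≠ 0. -/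
theorem inv_succ (p : ℝ) (N : ℕ) :
    (N + 1) * p * binomialExpectation p N (fun k => ((k : ℝ) + 1)⁻¹) =
      1 - (1 - p) ^ (N + 1) := by
  have h := natCast_mul p N (fun k => (k : ℝ)⁻¹)
  push_cast at h
  rw [← h]
  have h1 : (fun k : ℕ => (k : ℝ) * (k : ℝ)⁻¹) =
      fun k : ℕ => 1 + (-1) * (if k = 0 then (1 : ℝ) else 0) := by
    funext k
    rcases eq_or_ne k 0 with rfl | hk
    · simp
    · simp [hk]
  rw [h1, add, const_mul, const, indicator_zero]
  ring

/-- Induction by conditioning on one trial: the increment is 1/(N+1) - p E[1/(K+1)], which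
`inv_succ` evaluates to (1-p)^(N+1)/(N+1). -/
theorem harmonic_sub (p : ℝ) (N : ℕ) :
    binomialExpectation p N (fun k => (harmonic N : ℝ) - (harmonic k : ℝ)) =
      ∑ k ∈ Finset.range N, (1 - p) ^ (k + 1) / ((k : ℝ) + 1) := by
  induction N with
  | zero => simp [binomialExpectation]
  | succ N ih =>
    rw [Finset.sum_range_succ, ← ih, binomialExpectation]
    have h1 : (fun k : ℕ => (harmonic (N + 1) : ℝ) - (harmonic (k + 1) : ℝ)) =
        fun k : ℕ => (((harmonic N : ℝ) - (harmonic k : ℝ)) + ((N : ℝ) + 1)⁻¹) +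
          (-1) * ((k : ℝ) + 1)⁻¹ := by
      funext k; simp only [harmonic_succ]; push_cast; ring
    have h2 : (fun k : ℕ => (harmonic (N + 1) : ℝ) - (harmonic k : ℝ)) =
        fun k : ℕ => ((harmonic N : ℝ) - (harmonic k : ℝ)) + ((N : ℝ) + 1)⁻¹ := by
      funext k; simp only [harmonic_succ]; push_cast; ring
    rw [h1, h2, add, const_mul, add, const]
    have h3 := inv_succ p N
    have hN : (N : ℝ) + 1 ≠ 0 := by positivity
    set e := binomialExpectation p N (fun k => ((k : ℝ) + 1)⁻¹)
    have h4 : p * e = (1 - (1 - p) ^ (N + 1)) / (N + 1) := by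
      rw [← h3]; field_simp
    rw [div_eq_mul_inv] at h4 ⊢
    linear_combination -h4

end binomialExpectation

/-! ### Product measures and the Efron–Stein inequality -/

theorem card_filter_insertNth {α : Type*} [DecidableEq α] {n : ℕ} (i : Fin (n + 1)) (a b : α) (y : Fin n → α) :
    (Finset.univ.filter fun k => (i.insertNth a y : Fin (n + 1) → α) k = b).card =
      (if a = b then 1 else 0) + (Finset.univ.filter fun k => y k = b).card := by
  simp only [Finset.card_filter, Fin.sum_univ_succAbove _ i, Fin.insertNth_apply_same,
    Fin.insertNth_apply_succAbove]

theorem abs_le_sum_range {F : ℕ → ℝ} {k n : ℕ} (h : k ≤ n) :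
    |F k| ≤ ∑ j ∈ Finset.range (n + 1), |F j| :=
  Finset.single_le_sum (f := fun j => |F j|) (fun j _ => abs_nonneg _)
    (Finset.mem_range.mpr (by omega))

section Product

variable {α : Type*} [Countable α] [MeasurableSpace α] [DiscreteMeasurableSpace α]

theorem integrable_of_abs_le {β : Type*} [MeasurableSpace β] [DiscreteMeasurableSpace β]
    {μ : Measure β} [IsFiniteMeasure μ] {f : β → ℝ} {B : ℝ} (h : ∀ x, |f x| ≤ B) :
    Integrable f μ :=
  Integrable.of_bound Measurable.of_discrete.aestronglyMeasurable B (ae_of_all _ h)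

theorem integral_pi_insertNth (ν : Measure α) [IsProbabilityMeasure ν] {n : ℕ} (i : Fin (n + 1))
    {f : (Fin (n + 1) → α) → ℝ} {B : ℝ} (h : ∀ x, |f x| ≤ B) :
    ∫ x, f x ∂(Measure.pi fun _ : Fin (n + 1) => ν) =
      ∫ a, ∫ y, f (i.insertNth a y) ∂(Measure.pi fun _ : Fin n => ν) ∂ν := by
  have hm := (measurePreserving_piFinSuccAbove (fun _ : Fin (n + 1) => ν) i).symm
  rw [← hm.integral_comp (MeasurableEquiv.measurableEmbedding _), integral_prod]
  · rfl
  · exact integrable_of_abs_le fun x => h _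

theorem abs_integral_le_of_abs_le {β : Type*} [MeasurableSpace β]
    {μ : Measure β} [IsProbabilityMeasure μ] {f : β → ℝ} {B : ℝ} (h : ∀ x, |f x| ≤ B) :
    |∫ x, f x ∂μ| ≤ B := by
  simpa using norm_integral_le_of_norm_le_const (μ := μ) (f := f) (C := B) (ae_of_all _ h)

/-- The mean minimizes the mean squared deviation. -/
theorem integral_sq_sub_sq_integral_le {β : Type*} [MeasurableSpace β]
    [DiscreteMeasurableSpace β] {μ : Measure β} [IsProbabilityMeasure μ] {f : β → ℝ} {B : ℝ}
    (h : ∀ x, |f x| ≤ B) (c : ℝ) :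
    ∫ x, f x ^ 2 ∂μ - (∫ x, f x ∂μ) ^ 2 ≤ ∫ x, (f x - c) ^ 2 ∂μ := by
  have hi : Integrable f μ := integrable_of_abs_le h
  have hi2 : Integrable (fun x => f x ^ 2) μ := integrable_of_abs_le (B := B ^ 2) fun x => by
    rw [abs_pow]; gcongr; exact h x
  have : ∫ x, (f x - c) ^ 2 ∂μ = ∫ x, f x ^ 2 ∂μ - 2 * c * ∫ x, f x ∂μ + c ^ 2 := by
    have h1 : (fun x => (f x - c) ^ 2) = fun x => (f x ^ 2 - 2 * c * f x) + c ^ 2 := by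
      funext x; ring
    have hi1 : Integrable (fun x => 2 * c * f x) μ := hi.const_mul _
    rw [h1, integral_add (f := fun x => f x ^ 2 - 2 * c * f x) (hi2.sub hi1)
      (integrable_const _), integral_sub hi2 hi1, integral_const_mul]
    simp
  rw [this]
  nlinarith [sq_nonneg (∫ x, f x ∂μ - c)]

/-- The Efron–Stein inequality: the variance of a bounded function of independent coordinates is
at most the sum of its mean squared distances to functions not depending on one coordinate. -/
theorem efron_stein (ν : Measure α) [IsProbabilityMeasure ν] {n : ℕ}
    (f : (Fin n → α) → ℝ) (g : Fin n → (Fin n → α) → ℝ) {B : ℝ} (hf : ∀ x, |f x| ≤ B)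
    (hg : ∀ i x, |g i x| ≤ B) (hgi : ∀ i x b, g i (Function.update x i b) = g i x) :
    ∫ x, f x ^ 2 ∂(Measure.pi fun _ : Fin n => ν) -
        (∫ x, f x ∂(Measure.pi fun _ : Fin n => ν)) ^ 2 ≤
      ∑ i, ∫ x, (f x - g i x) ^ 2 ∂(Measure.pi fun _ : Fin n => ν) := by
  induction n with
  | zero =>
    have h1 : f = fun _ => f default := by funext x; rw [Subsingleton.elim x default]
    rw [h1]
    simp
  | succ n ih =>
    have hB : 0 ≤ B := by
      rcases isEmpty_or_nonempty α with h | ⟨⟨a⟩⟩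
      · exact absurd (measure_univ (μ := ν)) (by simp [Set.univ_eq_empty_iff.mpr h])
      · exact (abs_nonneg _).trans (hf fun _ => a)
    have hf2 : ∀ x, |f x ^ 2| ≤ B ^ 2 := fun x => by rw [abs_pow]; gcongr; exact hf x
    have hd : ∀ i x, |(f x - g i x) ^ 2| ≤ (B + B) ^ 2 := fun i x => by
      rw [abs_pow]; gcongr
      exact (abs_sub _ _).trans (add_le_add (hf x) (hg i x))
    set μ := Measure.pi fun _ : Fin n => ν with hμ
    set m : α → ℝ := fun b => ∫ y, f (Fin.insertNth 0 b y) ∂μ with hmdef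
    have hmB : ∀ b, |m b| ≤ B := fun b => abs_integral_le_of_abs_le fun y => hf _
    -- The variance splits into the mean conditional variance given the first coordinate b, handled
    -- by induction, and the variance of the conditional mean m.
    have hinner : ∀ b, ∫ y, f (Fin.insertNth 0 b y) ^ 2 ∂μ - m b ^ 2 ≤
        ∑ i : Fin n, ∫ y, (f (Fin.insertNth 0 b y) - g i.succ (Fin.insertNth 0 b y)) ^ 2 ∂μ := by
      intro b
      refine ih (fun y => f (Fin.insertNth 0 b y)) (fun i y => g i.succ (Fin.insertNth 0 b y))
        (fun y => hf _) (fun i y => hg _ _) fun i y c => ?_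
      rw [← hgi i.succ (Fin.insertNth 0 b y) c]
      congr 1
      simp [Fin.insertNth_zero']
    obtain ⟨a⟩ : Nonempty α := by
      by_contra h
      rw [not_nonempty_iff] at h
      exact absurd (measure_univ (μ := ν)) (by simp [Set.univ_eq_empty_iff.mpr h])
    set c : (Fin n → α) → ℝ := fun y => g 0 (Fin.insertNth 0 a y) with hc
    have hg0 : ∀ b y, g 0 (Fin.insertNth 0 b y) = c y := fun b y => by
      rw [hc, ← hgi 0 (Fin.insertNth 0 b y) a]
      simp [Fin.insertNth_zero', Fin.update_cons_zero]
    have hcB : ∀ y, |c y| ≤ B := fun y => hg _ _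
    -- As g 0 ignores the first coordinate, its mean over y is a constant; the variance of m is at
    -- most the mean square distance to it, and Jensen moves the square inside.
    have houter : ∫ b, m b ^ 2 ∂ν - (∫ b, m b ∂ν) ^ 2 ≤
        ∫ b, ∫ y, (f (Fin.insertNth 0 b y) - g 0 (Fin.insertNth 0 b y)) ^ 2 ∂μ ∂ν := by
      refine (integral_sq_sub_sq_integral_le hmB (∫ y, c y ∂μ)).trans ?_
      have hb : ∀ b, (m b - ∫ y, c y ∂μ) ^ 2 ≤
          ∫ y, (f (Fin.insertNth 0 b y) - g 0 (Fin.insertNth 0 b y)) ^ 2 ∂μ := by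
        intro b
        have h1 : m b - ∫ y, c y ∂μ = ∫ y, (f (Fin.insertNth 0 b y) - c y) ∂μ :=
          (integral_sub (integrable_of_abs_le fun y => hf _) (integrable_of_abs_le hcB)).symm
        have h3 : 0 ≤ ∫ y, (f (Fin.insertNth 0 b y) - c y) ^ 2 ∂μ -
            (∫ y, (f (Fin.insertNth 0 b y) - c y) ∂μ) ^ 2 := by
          have hv := ProbabilityTheory.variance_nonneg
            (fun y => f (Fin.insertNth 0 b y) - c y) μ
          rw [ProbabilityTheory.variance_eq_sub] at hv
          · exact hv
          · exact MemLp.of_bound Measurable.of_discrete.aestronglyMeasurable (B + B)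
              (ae_of_all _ fun y => (abs_sub _ _).trans (add_le_add (hf _) (hcB y)))
        simp only [hg0]
        rw [h1]
        linarith
      refine integral_mono (integrable_of_abs_le (B := (B + B) ^ 2) fun b => ?_)
        (integrable_of_abs_le (B := (B + B) ^ 2) fun b =>
          abs_integral_le_of_abs_le fun y => hd 0 _) hb
      rw [abs_pow]; gcongr
      exact (abs_sub _ _).trans (add_le_add (hmB b) (abs_integral_le_of_abs_le hcB))
    have hm2 : Integrable (fun b => m b ^ 2) ν := integrable_of_abs_le (B := B ^ 2) fun b => by
      rw [abs_pow]; gcongr; exact hmB b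
    have hf2i : Integrable (fun b => ∫ y, f (Fin.insertNth 0 b y) ^ 2 ∂μ) ν :=
      integrable_of_abs_le (B := B ^ 2) fun b => abs_integral_le_of_abs_le fun y => hf2 _
    have hint := integral_mono (μ := ν) (hf2i.sub hm2)
      (integrable_finsetSum Finset.univ fun i _ =>
        integrable_of_abs_le (B := (B + B) ^ 2) fun b =>
          abs_integral_le_of_abs_le fun y => hd i.succ (Fin.insertNth 0 b y)) hinner
    simp only [Pi.sub_apply] at hint
    rw [integral_sub hf2i hm2, integral_finsetSum _ (fun i _ =>
        integrable_of_abs_le (B := (B + B) ^ 2) fun b =>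
          abs_integral_le_of_abs_le fun y => hd i.succ (Fin.insertNth 0 b y))] at hint
    rw [Fin.sum_univ_succ, integral_pi_insertNth ν 0 hf2, integral_pi_insertNth ν 0 hf,
      integral_pi_insertNth ν 0 (hd 0)]
    simp_rw [fun i : Fin n => integral_pi_insertNth ν 0 (hd i.succ)]
    linarith

variable [DecidableEq α]

theorem integral_pi_card_filter (ν : Measure α) [IsProbabilityMeasure ν] (n : ℕ) (a : α)
    (F : ℕ → ℝ) :
    ∫ y, F (Finset.univ.filter fun k => y k = a).card ∂(Measure.pi fun _ : Fin n => ν) =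
      binomialExpectation (ν.real {a}) n F := by
  induction n generalizing F with
  | zero => simp [binomialExpectation]
  | succ n ih =>
    rw [integral_pi_insertNth ν 0 (B := ∑ j ∈ Finset.range (n + 1 + 1), |F j|) fun x =>
      abs_le_sum_range (by simpa using Finset.card_filter_le Finset.univ (fun k => x k = a))]
    simp only [card_filter_insertNth]
    rw [binomialExpectation, ← ih F, ← ih fun k => F (k + 1)]
    set u := ∫ y, F ((Finset.univ.filter fun k => y k = a).card + 1)
      ∂(Measure.pi fun _ : Fin n => ν) with hu
    set v := ∫ y, F (Finset.univ.filter fun k => y k = a).card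
      ∂(Measure.pi fun _ : Fin n => ν) with hv
    have h : ∀ b, ∫ y, F ((if b = a then 1 else 0) +
        (Finset.univ.filter fun k => y k = a).card) ∂(Measure.pi fun _ : Fin n => ν) =
        Set.indicator {a} (fun _ => u - v) b + v := by
      intro b
      by_cases hb : b = a
      · subst hb; simp [hu, add_comm]
      · simp [hb, hv]
    simp_rw [h]
    rw [integral_add ((integrable_const _).indicator (measurableSet_singleton a))
      (integrable_const _), integral_indicator_const _ (measurableSet_singleton a)]
    simp
    ring

end Product

/-- Fubini in coordinate i: once x i = a is fixed, the other N points hit a a binomial number of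
times. -/
theorem integral_pi_occurrences (ν : Measure ℕ+) [IsProbabilityMeasure ν] (N : ℕ)
    (i : Fin (N + 1)) (F : ℕ → ℝ) :
    ∫ x, F (occurrences x i - 1) ∂(Measure.pi fun _ : Fin (N + 1) => ν) =
      ∫ a, binomialExpectation (ν.real {a}) N F ∂ν := by
  have hocc : ∀ x : Fin (N + 1) → ℕ+, occurrences x i ≤ N + 1 := fun x => by
    simpa [occurrences] using Finset.card_filter_le Finset.univ (fun k => x k = x i)
  rw [integral_pi_insertNth ν i (B := ∑ j ∈ Finset.range (N + 1), |F j|) fun x =>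
      abs_le_sum_range (by have := hocc x; omega)]
  refine integral_congr_ae (ae_of_all _ fun a => ?_)
  simp only [occurrences, Fin.insertNth_apply_same, card_filter_insertNth, if_true,
    Nat.add_sub_cancel_left]
  exact integral_pi_card_filter ν N a F

/-! ### Tail of the logarithm series -/

/-- The remainder of the expansion `-log p = ∑ (1 - p) ^ k / k` after `N` terms. -/
noncomputable def logRemainder (p : ℝ) (N : ℕ) : ℝ :=
  -Real.log p - ∑ k ∈ Finset.range N, (1 - p) ^ (k + 1) / ((k : ℝ) + 1)

theorem hasSum_logRemainder {p : ℝ} (h0 : 0 < p) (h1 : p ≤ 1) (N : ℕ) :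
    HasSum (fun k : ℕ => (1 - p) ^ (k + N + 1) / (((k + N : ℕ) : ℝ) + 1)) (logRemainder p N) := by
  have h := Real.hasSum_pow_div_log_of_abs_lt_one (x := 1 - p)
    (by rw [abs_lt]; constructor <;> linarith)
  rw [sub_sub_cancel] at h
  exact (hasSum_nat_add_iff' N).mpr h

theorem logRemainder_nonneg {p : ℝ} (h0 : 0 < p) (h1 : p ≤ 1) (N : ℕ) : 0 ≤ logRemainder p N :=
  (hasSum_logRemainder h0 h1 N).nonneg fun k => by
    have : 0 ≤ 1 - p := by linarith
    positivity

/-- The tail is dominated by the geometric series ∑ (1-p)^k / (N+1). -/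
theorem mul_logRemainder_le_one {p : ℝ} (h0 : 0 < p) (h1 : p ≤ 1) (N : ℕ) :
    ((N : ℝ) + 1) * p * logRemainder p N ≤ 1 := by
  have hq : 0 ≤ 1 - p := by linarith
  have hg := (hasSum_geometric_of_lt_one hq (by linarith)).mul_left (((N : ℝ) + 1)⁻¹)
  have h := hasSum_le (fun k => ?_) (hasSum_logRemainder h0 h1 N) hg
  · rw [sub_sub_cancel] at h
    calc ((N : ℝ) + 1) * p * logRemainder p N
        ≤ ((N : ℝ) + 1) * p * (((N : ℝ) + 1)⁻¹ * p⁻¹) := by gcongr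
      _ = 1 := by field_simp
  · rw [div_eq_mul_inv, mul_comm]
    gcongr ?_ * ?_
    · gcongr
      linarith [(Nat.cast_nonneg k : (0 : ℝ) ≤ k)]
    · exact pow_le_pow_of_le_one hq (by linarith) (by omega)

/-- Bernoulli's inequality bounds the partial sum below by J(N) - N p, and J(N) ≥ log(N+1). -/
theorem logRemainder_le {p : ℝ} (h0 : 0 < p) (h1 : p ≤ 1) (N : ℕ) :
    logRemainder p N ≤ ((N : ℝ) + 1) * p - Real.log (((N : ℝ) + 1) * p) := by
  have h : ∀ k ∈ Finset.range N,
      ((k : ℝ) + 1)⁻¹ - p ≤ (1 - p) ^ (k + 1) / ((k : ℝ) + 1) := by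
    intro k _
    have hb := one_add_mul_le_pow (a := -p) (by linarith) (k + 1)
    have hk : (0 : ℝ) < (k : ℝ) + 1 := by positivity
    rw [le_div_iff₀ hk, sub_mul, inv_mul_cancel₀ hk.ne']
    push_cast at hb
    rw [← sub_eq_add_neg] at hb
    linarith
  have hs := Finset.sum_le_sum h
  rw [Finset.sum_sub_distrib] at hs
  have hJ : ∑ k ∈ Finset.range N, ((k : ℝ) + 1)⁻¹ = (harmonic N : ℝ) := by
    simp [harmonic]
  have hl := log_add_one_le_harmonic N
  push_cast at hl
  rw [hJ] at hs
  rw [Real.log_mul (by positivity) h0.ne']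
  simp only [Finset.sum_const, Finset.card_range, nsmul_eq_mul] at hs
  unfold logRemainder
  linarith

/-- Merges the two preceding bounds into one profile of order (1+t)^(-3/2), summable over the grid t
= j/r. For v ≥ 1 the bound 1 suffices, as t ≤ 1; for v < 1 the logarithm costs a quarter power,
leaving v^(3/4). -/
theorem mul_logRemainder_le {p t : ℝ} (h0 : 0 < p) (h1 : p ≤ 1) (N : ℕ) (ht : 0 < t)
    (hv : ((N : ℝ) + 1) * p * t ^ 2 ≤ 1) :
    ((N : ℝ) + 1) * p * logRemainder p N ≤ 15 / Real.sqrt (1 + t) ^ 3 := by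
  have hR1 := mul_logRemainder_le_one h0 h1 N
  have hR2 := logRemainder_le h0 h1 N
  set s := Real.sqrt (1 + t) with hs
  have hs0 : 0 < s := Real.sqrt_pos.mpr (by linarith)
  have hs2 : s ^ 2 = 1 + t := Real.sq_sqrt (by linarith)
  set v := ((N : ℝ) + 1) * p with hvdef
  have hv0 : 0 < v := by positivity
  rw [le_div_iff₀ (by positivity)]
  rcases le_or_gt 1 v with h | h
  · have ht1 : t ≤ 1 := by nlinarith
    have hs3 : s ≤ 2 := by nlinarith
    have : s ^ 3 ≤ 2 ^ 3 := by gcongr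
    have h0 : 0 ≤ s ^ 3 := by positivity
    nlinarith
  · set y := Real.sqrt (Real.sqrt v) with hy
    have hy0 : 0 < y := Real.sqrt_pos.mpr (Real.sqrt_pos.mpr hv0)
    have hy4 : y ^ 4 = v := by
      rw [show y ^ 4 = (y ^ 2) ^ 2 by ring, Real.sq_sqrt (Real.sqrt_nonneg _),
        Real.sq_sqrt hv0.le]
    have hy1 : y ≤ 1 := by
      by_contra hc
      push Not at hc
      have := one_lt_pow₀ hc (n := 4) (by norm_num)
      linarith
    have hlog : -Real.log v ≤ 4 * (y⁻¹ - 1) := by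
      have := Real.log_le_sub_one_of_pos (inv_pos.mpr hy0)
      rw [Real.log_inv] at this
      rw [← hy4, Real.log_pow]
      push_cast
      linarith
    have hvR : v * logRemainder p N ≤ 5 * y ^ 3 := by
      have hy3 : 0 ≤ y ^ 3 := by positivity
      calc v * logRemainder p N ≤ v * (v - Real.log v) := by gcongr
        _ ≤ v * (1 + 4 * (y⁻¹ - 1)) := by gcongr; linarith
        _ = 4 * y ^ 3 - 3 * y ^ 4 := by rw [← hy4]; field_simp; ring
        _ ≤ 5 * y ^ 3 := by nlinarith [pow_pos hy0 4]
    -- v (1+t)² ≤ 2 v (1+t²) ≤ 4, from v < 1 and v t² ≤ 1.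
    have hys : (y * s) ^ 4 ≤ 4 := by
      have : (y * s) ^ 4 = v * (1 + t) ^ 2 := by rw [← hs2, ← hy4]; ring
      rw [this]
      nlinarith [mul_nonneg hv0.le (sq_nonneg (1 - t))]
    have hys0 : 0 < y * s := by positivity
    have hys2 : (y * s) ^ 2 ≤ 2 := by nlinarith [sq_nonneg (y * s)]
    have hys1 : y * s ≤ 3 / 2 := by nlinarith
    have hys3 : (y * s) ^ 3 ≤ 3 := by nlinarith [sq_nonneg (y * s)]
    calc v * logRemainder p N * s ^ 3 ≤ 5 * y ^ 3 * s ^ 3 := by gcongr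
      _ = 5 * (y * s) ^ 3 := by ring
      _ ≤ 15 := by linarith

/-- Telescoping: for consecutive roots a ≤ b, 1/a - 1/b = 1/(r a b (a+b)) ≥ 1/(2 r b³). -/
theorem sum_inv_sqrt_cube_le {r : ℝ} (hr : 0 < r) (M : ℕ) :
    ∑ j ∈ Finset.range M, 15 / Real.sqrt (1 + ((j : ℝ) + 1) / r) ^ 3 ≤ 30 * r := by
  have hterm : ∀ j : ℕ, 15 / Real.sqrt (1 + ((j : ℝ) + 1) / r) ^ 3 ≤
      30 * r * (Real.sqrt (1 + (j : ℝ) / r))⁻¹ -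
        30 * r * (Real.sqrt (1 + ((j + 1 : ℕ) : ℝ) / r))⁻¹ := by
    intro j
    push_cast
    set a := Real.sqrt (1 + (j : ℝ) / r) with ha
    set b := Real.sqrt (1 + ((j : ℝ) + 1) / r) with hb
    have hja : 0 < 1 + (j : ℝ) / r := by positivity
    have hjb : 0 < 1 + ((j : ℝ) + 1) / r := by positivity
    have ha0 : 0 < a := Real.sqrt_pos.mpr hja
    have hb0 : 0 < b := Real.sqrt_pos.mpr hjb
    have hab : a ≤ b := Real.sqrt_le_sqrt (by gcongr; linarith)
    have hr' : r * (b - a) * (b + a) = 1 := by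
      have h1 : a ^ 2 = 1 + (j : ℝ) / r := Real.sq_sqrt hja.le
      have h2 : b ^ 2 = 1 + ((j : ℝ) + 1) / r := Real.sq_sqrt hjb.le
      have : r * (b - a) * (b + a) = r * (b ^ 2 - a ^ 2) := by ring
      rw [this, h1, h2]
      field_simp
      ring
    have h3 : 30 * r * a⁻¹ - 30 * r * b⁻¹ = 30 / (a * b * (b + a)) := by
      have : r * (b - a) = 1 / (b + a) := by rw [← hr']; field_simp
      calc 30 * r * a⁻¹ - 30 * r * b⁻¹ = 30 * (r * (b - a)) / (a * b) := by field_simp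
        _ = _ := by rw [this]; field_simp
    rw [h3, div_le_div_iff₀ (by positivity) (by positivity)]
    have h4 : a * b * (b + a) ≤ b * b * (b + b) := by gcongr
    nlinarith
  refine (Finset.sum_le_sum fun j _ => hterm j).trans ?_
  rw [Finset.sum_range_sub' (fun j : ℕ => 30 * r * (Real.sqrt (1 + (j : ℝ) / r))⁻¹)]
  have : 0 ≤ 30 * r * (Real.sqrt (1 + (M : ℝ) / r))⁻¹ := by positivity
  simp only [Nat.cast_zero, zero_div, add_zero, Real.sqrt_one, inv_one, mul_one]
  linarith

/-! ### Second moment of a single harmonic term -/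

theorem harmonic_mono_real {a b : ℕ} (h : a ≤ b) : (harmonic a : ℝ) ≤ (harmonic b : ℝ) := by
  refine Nat.le_induction (m := a) le_rfl (fun n _ ih => ih.trans ?_) b h
  rw [harmonic_succ]
  push_cast
  linarith [show (0 : ℝ) ≤ ((n : ℝ) + 1)⁻¹ by positivity]

/-- The difference is at most log u + 2/3 with u = (N+1)/(k+1), and log u ≤ 8 (u^(1/8) - 1). The
exponent 1/8 is small enough that p^(3/4) is left for summation. -/
theorem sq_harmonic_sub_le {k N : ℕ} (h : k ≤ N) :
    ((harmonic N : ℝ) - (harmonic k : ℝ)) ^ 2 ≤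
      64 * (((N : ℝ) + 1) * ((k : ℝ) + 1)⁻¹) ^ (1 / 4 : ℝ) := by
  have h1 := Real.eulerMascheroniSeq_lt_eulerMascheroniConstant N
  have h2 := Real.eulerMascheroniConstant_lt_two_thirds
  have h3 := Real.strictMono_eulerMascheroniSeq.monotone (Nat.zero_le k)
  rw [Real.eulerMascheroniSeq_zero] at h3
  simp only [Real.eulerMascheroniSeq] at h1 h3
  set u := ((N : ℝ) + 1) * ((k : ℝ) + 1)⁻¹ with hu
  have hu0 : 0 < u := by positivity
  have hlogu : Real.log u = Real.log (N + 1) - Real.log (k + 1) := by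
    rw [hu, ← div_eq_mul_inv, Real.log_div (by positivity) (by positivity)]
  have hl := Real.log_le_sub_one_of_pos (Real.rpow_pos_of_pos hu0 (1 / 8 : ℝ))
  rw [Real.log_rpow hu0] at hl
  have hsq : u ^ (1 / 4 : ℝ) = (u ^ (1 / 8 : ℝ)) ^ 2 := by
    rw [← Real.rpow_natCast, ← Real.rpow_mul hu0.le]; norm_num
  have h0 : 0 ≤ (harmonic N : ℝ) - (harmonic k : ℝ) := sub_nonneg.mpr (harmonic_mono_real h)
  have hle : (harmonic N : ℝ) - (harmonic k : ℝ) ≤ 8 * u ^ (1 / 8 : ℝ) := by linarith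
  rw [hsq]
  nlinarith

theorem mul_binomialExpectation_sq_le {p : ℝ} (h0 : 0 ≤ p) (h1 : p ≤ 1) (N : ℕ) :
    p * binomialExpectation p N (fun k => ((harmonic N : ℝ) - (harmonic k : ℝ)) ^ 2) ≤
      128 * p ^ (3 / 4 : ℝ) := by
  rcases h0.eq_or_lt with rfl | hp
  · simp
  have hm : ∀ k ≤ N, ((harmonic N : ℝ) - (harmonic k : ℝ)) ^ 2 ≤
      64 * p ^ (-(1 / 4) : ℝ) * (((N : ℝ) + 1) * p * ((k : ℝ) + 1)⁻¹ + 1) := by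
    intro k hk
    refine (sq_harmonic_sub_le hk).trans ?_
    set u := ((N : ℝ) + 1) * ((k : ℝ) + 1)⁻¹ with hu
    have hu0 : 0 < u := by positivity
    -- Linearising in p u pays off because its binomial mean is at most 1, by `inv_succ`.
    have hpu : (p * u) ^ (1 / 4 : ℝ) ≤ p * u + 1 := by
      rcases le_total (p * u) 1 with h | h
      · have := Real.rpow_le_one (by positivity) h (show (0 : ℝ) ≤ 1 / 4 by norm_num)
        have : 0 < p * u := by positivity
        linarith
      · have := Real.rpow_le_rpow_of_exponent_le h (show (1 / 4 : ℝ) ≤ 1 by norm_num)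
        rw [Real.rpow_one] at this
        linarith
    have hsplit : u ^ (1 / 4 : ℝ) = p ^ (-(1 / 4) : ℝ) * (p * u) ^ (1 / 4 : ℝ) := by
      rw [Real.mul_rpow hp.le hu0.le, ← mul_assoc, ← Real.rpow_add hp]
      norm_num
    rw [hsplit, ← mul_assoc]
    have : ((N : ℝ) + 1) * p * ((k : ℝ) + 1)⁻¹ = p * u := by rw [hu]; ring
    rw [this]
    gcongr
  have hE := binomialExpectation.mono h0 h1 hm
  rw [binomialExpectation.const_mul, binomialExpectation.add, binomialExpectation.const_mul,
    binomialExpectation.const, binomialExpectation.inv_succ] at hE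
  have hq : 0 ≤ (1 - p) ^ (N + 1) := pow_nonneg (by linarith) _
  have hpow : p * p ^ (-(1 / 4) : ℝ) = p ^ (3 / 4 : ℝ) := by
    nth_rewrite 1 [← Real.rpow_one p]
    rw [← Real.rpow_add hp]
    norm_num
  calc _ ≤ p * (64 * p ^ (-(1 / 4) : ℝ) * (1 - (1 - p) ^ (N + 1) + 1)) := by gcongr
    _ ≤ p * (64 * p ^ (-(1 / 4) : ℝ) * 2) := by gcongr; linarith
    _ = 128 * (p * p ^ (-(1 / 4) : ℝ)) := by ring
    _ = _ := by rw [hpow]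

/-! ### Bias and second moment over the class -/

theorem toMeasure_real_singleton (p : PMF ℕ+) (a : ℕ+) : p.toMeasure.real {a} = (p a).toReal := by
  rw [Measure.real, PMF.toMeasure_apply_singleton p a (measurableSet_singleton a)]

theorem toReal_pmf_le_one (p : PMF ℕ+) (a : ℕ+) : (p a).toReal ≤ 1 :=
  ENNReal.toReal_le_of_le_ofReal zero_le_one (by simpa using p.coe_le_one a)

theorem nonneg_of_mem_quadraticTailClass {C : ℝ} {p : PMF ℕ+} (hp : p ∈ quadraticTailClass C) :
    0 ≤ C := by
  have h := (ENNReal.toReal_nonneg (a := p 1)).trans (hp 1)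
  simpa using h

theorem summable_toReal (p : PMF ℕ+) : Summable fun j => (p j).toReal :=
  ENNReal.summable_toReal p.tsum_coe_ne_top

theorem summable_toReal_mul (p : PMF ℕ+) {F : ℕ+ → ℝ} {B : ℝ} (hF : ∀ a, |F a| ≤ B) :
    Summable fun j => (p j).toReal * F j := by
  refine Summable.of_norm_bounded ((summable_toReal p).mul_right B) fun j => ?_
  rw [Real.norm_eq_abs, abs_mul, abs_of_nonneg ENNReal.toReal_nonneg]
  exact mul_le_mul_of_nonneg_left (hF j) ENNReal.toReal_nonneg

theorem integral_toMeasure_eq_tsum (p : PMF ℕ+) {F : ℕ+ → ℝ} {B : ℝ} (hF : ∀ a, |F a| ≤ B) :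
    ∫ a, F a ∂p.toMeasure = ∑' j, (p j).toReal * F j := by
  rw [PMF.integral_eq_tsum p F (integrable_of_abs_le hF)]
  rfl

theorem abs_binomialExpectation_le {p : ℝ} (h0 : 0 ≤ p) (h1 : p ≤ 1) (N : ℕ) (F : ℕ → ℝ) :
    |binomialExpectation p N F| ≤ ∑ j ∈ Finset.range (N + 1), |F j| := by
  have hb : ∀ k ≤ N, |F k| ≤ ∑ j ∈ Finset.range (N + 1), |F j| := fun k hk => abs_le_sum_range hk
  refine abs_le.mpr ⟨?_, ?_⟩
  · rw [← binomialExpectation.const p N (-∑ j ∈ Finset.range (N + 1), |F j|)]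
    exact binomialExpectation.mono h0 h1 fun k hk => (abs_le.mp (hb k hk)).1
  · rw [← binomialExpectation.const p N (∑ j ∈ Finset.range (N + 1), |F j|)]
    exact binomialExpectation.mono h0 h1 fun k hk => (abs_le.mp (hb k hk)).2

theorem integral_binomialExpectation (p : PMF ℕ+) (N : ℕ) (F : ℕ → ℝ) :
    ∫ a, binomialExpectation (p.toMeasure.real {a}) N F ∂p.toMeasure =
      ∑' j, (p j).toReal * binomialExpectation (p j).toReal N F := by
  simp_rw [toMeasure_real_singleton]
  exact integral_toMeasure_eq_tsum p fun a =>
    abs_binomialExpectation_le ENNReal.toReal_nonneg (toReal_pmf_le_one p a) N F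

theorem summable_binomialExpectation (p : PMF ℕ+) (N : ℕ) (F : ℕ → ℝ) :
    Summable fun j => (p j).toReal * binomialExpectation (p j).toReal N F :=
  summable_toReal_mul p fun a =>
    abs_binomialExpectation_le ENNReal.toReal_nonneg (toReal_pmf_le_one p a) N F

theorem summable_threeHalves (C : ℝ) :
    Summable fun j : ℕ+ => 128 * C ^ (3 / 4 : ℝ) * (1 / ((j : ℕ) : ℝ) ^ (3 / 2 : ℝ)) :=
  ((Real.summable_one_div_nat_rpow.mpr (by norm_num)).comp_injective
    PNat.coe_injective).mul_left _

theorem integral_binomialExpectation_sq_le {C : ℝ} {p : PMF ℕ+} (hp : p ∈ quadraticTailClass C)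
    (N : ℕ) :
    ∫ a, binomialExpectation (p.toMeasure.real {a}) N
        (fun k => ((harmonic N : ℝ) - (harmonic k : ℝ)) ^ 2) ∂p.toMeasure ≤
      ∑' j : ℕ+, 128 * C ^ (3 / 4 : ℝ) * (1 / ((j : ℕ) : ℝ) ^ (3 / 2 : ℝ)) := by
  rw [integral_binomialExpectation]
  refine (summable_binomialExpectation p N _).tsum_le_tsum (fun j => ?_) (summable_threeHalves C)
  refine (mul_binomialExpectation_sq_le ENNReal.toReal_nonneg (toReal_pmf_le_one p j) N).trans ?_
  have hj : (0 : ℝ) < ((j : ℕ) : ℝ) := by exact_mod_cast j.pos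
  have h := Real.rpow_le_rpow ENNReal.toReal_nonneg (hp j) (show (0 : ℝ) ≤ 3 / 4 by norm_num)
  rw [Real.div_rpow (nonneg_of_mem_quadraticTailClass hp) (by positivity), ← Real.rpow_natCast,
    ← Real.rpow_mul hj.le] at h
  norm_num at h
  rw [mul_assoc, mul_one_div]
  gcongr

/-- The bias of the harmonic estimator. -/
theorem shannonEntropy_sub_integral {C : ℝ} {p : PMF ℕ+} (hp : p ∈ quadraticTailClass C)
    (N : ℕ) :
    HasSum (fun j => (p j).toReal * logRemainder (p j).toReal N) (shannonEntropy p -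
      ∫ a, binomialExpectation (p.toMeasure.real {a}) N
        (fun k => (harmonic N : ℝ) - (harmonic k : ℝ)) ∂p.toMeasure) := by
  rw [integral_binomialExpectation]
  refine ((summable_negMulLog_of_mem_quadraticTailClass hp).hasSum.sub
    (summable_binomialExpectation p N _).hasSum).congr_fun fun j => ?_
  rw [binomialExpectation.harmonic_sub, logRemainder, Real.negMulLog]
  ring

theorem abs_shannonEntropy_sub_integral_le {C : ℝ} {p : PMF ℕ+} (hp : p ∈ quadraticTailClass C)
    (hC : 0 < C) (N : ℕ) :
    |shannonEntropy p - ∫ a, binomialExpectation (p.toMeasure.real {a}) N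
        (fun k => (harmonic N : ℝ) - (harmonic k : ℝ)) ∂p.toMeasure| ≤
      30 * Real.sqrt (C * (N + 1)) / (N + 1) := by
  have hs := shannonEntropy_sub_integral hp N
  have hnn : ∀ j, 0 ≤ (p j).toReal * logRemainder (p j).toReal N := fun j => by
    rcases (ENNReal.toReal_nonneg (a := p j)).eq_or_lt with h | h
    · rw [← h, zero_mul]
    · exact mul_nonneg h.le (logRemainder_nonneg h (toReal_pmf_le_one p j) N)
  rw [abs_of_nonneg (hs.nonneg hnn)]
  have hn : (0 : ℝ) < (N : ℝ) + 1 := by positivity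
  set r := Real.sqrt (C * (N + 1)) with hr
  have hr0 : 0 < r := Real.sqrt_pos.mpr (by positivity)
  have hr2 : r ^ 2 = C * (N + 1) := Real.sq_sqrt (by positivity)
  have hs' := hs.mul_left ((N : ℝ) + 1)
  -- Index j : ℕ stands for the point j + 1, and t = (j+1)/r satisfies n p t² ≤ n C / r² = 1.
  rw [← Equiv.pnatEquivNat.symm.hasSum_iff] at hs'
  rw [le_div_iff₀ hn, mul_comm, ← hs'.tsum_eq]
  refine Real.tsum_le_of_sum_range_le (fun j => mul_nonneg hn.le (hnn _)) fun M =>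
    (Finset.sum_le_sum fun j _ => ?_).trans (sum_inv_sqrt_cube_le hr0 M)
  rw [Function.comp_apply]
  set a := Equiv.pnatEquivNat.symm j with ha
  rcases (ENNReal.toReal_nonneg (a := p a)).eq_or_lt with h | h
  · rw [← h, zero_mul, mul_zero]
    positivity
  · rw [← mul_assoc]
    refine mul_logRemainder_le h (toReal_pmf_le_one p a) N (by positivity) ?_
    have hle := hp a
    have hcast : ((a : ℕ) : ℝ) = (j : ℝ) + 1 := by
      rw [ha]; simp [Equiv.pnatEquivNat]
    rw [hcast] at hle
    calc ((N : ℝ) + 1) * (p a).toReal * (((j : ℝ) + 1) / r) ^ 2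
        ≤ ((N : ℝ) + 1) * (C / ((j : ℝ) + 1) ^ 2) * (((j : ℝ) + 1) / r) ^ 2 := by gcongr
      _ = 1 := by rw [div_pow, hr2]; field_simp

/-! ### Leave-one-out comparison and the variance -/

/-- Number of sample points other than the `i`-th one that equal the `k`-th one. -/
def occurrencesExcept {n : ℕ} (x : Fin n → ℕ+) (i k : Fin n) : ℕ :=
  ((Finset.univ.erase i).filter fun l => x l = x k).card

theorem occurrences_le {n : ℕ} (x : Fin n → ℕ+) (i : Fin n) : occurrences x i ≤ n := by
  simpa [occurrences] using Finset.card_filter_le Finset.univ (fun k => x k = x i)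

theorem occurrencesExcept_le {n : ℕ} (x : Fin n → ℕ+) (i k : Fin n) :
    occurrencesExcept x i k ≤ occurrences x k :=
  Finset.card_le_card (Finset.filter_subset_filter _ (Finset.erase_subset _ _))

theorem occurrencesExcept_update {n : ℕ} (x : Fin n → ℕ+) {i k : Fin n} (hk : k ≠ i) (b : ℕ+) :
    occurrencesExcept (Function.update x i b) i k = occurrencesExcept x i k := by
  unfold occurrencesExcept
  congr 1
  refine Finset.filter_congr fun l hl => ?_
  rw [Function.update_of_ne (Finset.ne_of_mem_erase hl), Function.update_of_ne hk]

theorem occurrences_eq_occurrencesExcept_add {n : ℕ} (x : Fin n → ℕ+) (i k : Fin n) :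
    occurrences x k = occurrencesExcept x i k + if x i = x k then 1 else 0 := by
  unfold occurrences occurrencesExcept
  rw [Finset.filter_erase]
  split_ifs with h
  · exact (Finset.card_erase_add_one (by simp [h])).symm
  · rw [Finset.erase_eq_of_notMem (by simp [h]), add_zero]

/-- Removing the `i`-th sample point changes the other harmonic terms by at most one in total. -/
theorem sum_harmonic_sub_mem_Icc {n : ℕ} (x : Fin n → ℕ+) (i : Fin n) :
    ∑ k ∈ Finset.univ.erase i, ((harmonic (occurrences x k - 1) : ℝ) -
      (harmonic (occurrencesExcept x i k - 1) : ℝ)) ∈ Set.Icc (0 : ℝ) 1 := by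
  refine ⟨Finset.sum_nonneg fun k _ => sub_nonneg.mpr (harmonic_mono_real
    (Nat.sub_le_sub_right (occurrencesExcept_le x i k) 1)), ?_⟩
  have hterm : ∀ k ∈ Finset.univ.erase i, (harmonic (occurrences x k - 1) : ℝ) -
      (harmonic (occurrencesExcept x i k - 1) : ℝ) =
      if x k = x i then ((occurrencesExcept x i i : ℕ) : ℝ)⁻¹ else 0 := by
    intro k hk
    have h := occurrences_eq_occurrencesExcept_add x i k
    by_cases hki : x k = x i
    · have hc : occurrencesExcept x i k = occurrencesExcept x i i := by
        unfold occurrencesExcept; rw [hki]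
      -- As k ≠ i, the point k counts itself, so the truncated subtraction of 1 is genuine.
      have hpos : 0 < occurrencesExcept x i k :=
        Finset.card_pos.mpr ⟨k, Finset.mem_filter.mpr ⟨hk, rfl⟩⟩
      rw [if_pos hki.symm] at h
      rw [if_pos hki, ← hc, h]
      obtain ⟨m, hm⟩ := Nat.exists_eq_add_of_lt hpos
      rw [hm, Nat.add_sub_cancel, zero_add, Nat.add_sub_cancel, harmonic_succ]
      push_cast
      ring
    · rw [if_neg (Ne.symm hki), add_zero] at h
      rw [h, if_neg hki, sub_self]
  rw [Finset.sum_congr rfl hterm, ← Finset.sum_filter, Finset.sum_const, nsmul_eq_mul]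
  -- If c other points equal x i, each contributes 1/c; the total is 1, or 0 when c = 0.
  exact mul_inv_le_one

theorem integral_pi_harmonicEstimator (ν : Measure ℕ+) [IsProbabilityMeasure ν] (N : ℕ) :
    ∫ x, harmonicEstimator (N + 1) x ∂(Measure.pi fun _ : Fin (N + 1) => ν) =
      ∫ a, binomialExpectation (ν.real {a}) N
        (fun k => (harmonic N : ℝ) - (harmonic k : ℝ)) ∂ν := by
  unfold harmonicEstimator
  rw [integral_const_mul, integral_finsetSum]
  · simp only [Nat.add_sub_cancel]
    simp_rw [fun i => integral_pi_occurrences ν N i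
      (fun k => (harmonic N : ℝ) - (harmonic k : ℝ))]
    rw [Finset.sum_const, Finset.card_univ, Fintype.card_fin, nsmul_eq_mul]
    field_simp
  · intro i _
    refine integrable_of_abs_le (B := ∑ j ∈ Finset.range (N + 1 + 1),
      |(harmonic (N + 1 - 1) : ℝ) - (harmonic j : ℝ)|) fun x =>
      abs_le_sum_range (F := fun j => (harmonic (N + 1 - 1) : ℝ) - (harmonic j : ℝ))
        ((Nat.sub_le _ 1).trans (occurrences_le x i))

theorem abs_mul_sum_le {n : ℕ} (s : Finset (Fin n)) {F : Fin n → ℝ} {B : ℝ}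
    (hF : ∀ i, |F i| ≤ B) (hB : 0 ≤ B) : |(1 / (n : ℝ)) * ∑ i ∈ s, F i| ≤ B := by
  rcases Nat.eq_zero_or_pos n with rfl | hn
  · simpa using hB
  have hn' : (0 : ℝ) < n := by exact_mod_cast hn
  have hs : (s.card : ℝ) ≤ n := by
    exact_mod_cast (Finset.card_le_univ s).trans_eq (Fintype.card_fin n)
  rw [abs_mul, abs_of_nonneg (by positivity : (0 : ℝ) ≤ 1 / n), one_div, inv_mul_le_iff₀ hn']
  calc |∑ i ∈ s, F i| ≤ ∑ i ∈ s, B :=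
        (Finset.abs_sum_le_sum_abs _ _).trans (Finset.sum_le_sum fun i _ => hF i)
    _ = s.card * B := by rw [Finset.sum_const, nsmul_eq_mul]
    _ ≤ n * B := by gcongr

theorem abs_harmonicEstimator_le {n : ℕ} (x : Fin n → ℕ+) :
    |harmonicEstimator n x| ≤
      ∑ j ∈ Finset.range (n + 1), |(harmonic (n - 1) : ℝ) - (harmonic j : ℝ)| :=
  abs_mul_sum_le _ (fun i => abs_le_sum_range
    (F := fun j => (harmonic (n - 1) : ℝ) - (harmonic j : ℝ))
    ((Nat.sub_le _ 1).trans (occurrences_le x i))) (Finset.sum_nonneg fun _ _ => abs_nonneg _)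

theorem variance_harmonicEstimator_le (ν : Measure ℕ+) [IsProbabilityMeasure ν] (N : ℕ) :
    ∫ x, harmonicEstimator (N + 1) x ^ 2 ∂(Measure.pi fun _ : Fin (N + 1) => ν) -
        (∫ x, harmonicEstimator (N + 1) x ∂(Measure.pi fun _ : Fin (N + 1) => ν)) ^ 2 ≤
      (∫ a, binomialExpectation (ν.real {a}) N
        (fun k => ((harmonic N : ℝ) - (harmonic k : ℝ)) ^ 2) ∂ν + 1) / (N + 1) := by
  -- The factor 1/(N+1) is kept after deletion, so only the i-th term and the shifts of the other
  -- counts remain in the difference.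
  set g : Fin (N + 1) → (Fin (N + 1) → ℕ+) → ℝ := fun i x =>
    (1 / ((N + 1 : ℕ) : ℝ)) * ∑ k ∈ Finset.univ.erase i,
      ((harmonic (N + 1 - 1) : ℝ) - (harmonic (occurrencesExcept x i k - 1) : ℝ)) with hg
  refine (efron_stein ν (harmonicEstimator (N + 1)) g abs_harmonicEstimator_le
    (fun i x => abs_mul_sum_le _ (fun k => abs_le_sum_range
      (F := fun j => (harmonic (N + 1 - 1) : ℝ) - (harmonic j : ℝ))
      ((Nat.sub_le _ 1).trans ((occurrencesExcept_le x i k).trans (occurrences_le x k))))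
      (Finset.sum_nonneg fun _ _ => abs_nonneg _)) fun i x b => ?_).trans ?_
  · simp only [hg]
    congr 1
    refine Finset.sum_congr rfl fun k hk => ?_
    rw [occurrencesExcept_update x (Finset.ne_of_mem_erase hk)]
  have hpt : ∀ i x, (harmonicEstimator (N + 1) x - g i x) ^ 2 ≤ (1 / ((N + 1 : ℕ) : ℝ)) ^ 2 *
      (((harmonic N : ℝ) - (harmonic (occurrences x i - 1) : ℝ)) ^ 2 + 1) := by
    intro i x
    obtain ⟨h0, h1⟩ := sum_harmonic_sub_mem_Icc x i
    set d := ∑ k ∈ Finset.univ.erase i, ((harmonic (occurrences x k - 1) : ℝ) -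
      (harmonic (occurrencesExcept x i k - 1) : ℝ)) with hd
    have hdiff : harmonicEstimator (N + 1) x - g i x = (1 / ((N + 1 : ℕ) : ℝ)) *
        (((harmonic N : ℝ) - (harmonic (occurrences x i - 1) : ℝ)) - d) := by
      simp only [harmonicEstimator, hg, hd, ← mul_sub,
        ← Finset.add_sum_erase Finset.univ _ (Finset.mem_univ i), Finset.sum_sub_distrib,
        Nat.add_sub_cancel]
      ring
    have hnn : 0 ≤ (harmonic N : ℝ) - (harmonic (occurrences x i - 1) : ℝ) :=
      sub_nonneg.mpr (harmonic_mono_real (by have := occurrences_le x i; omega))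
    rw [hdiff, mul_pow]
    gcongr
    -- For a ≥ 0 and 0 ≤ d ≤ 1, (a - d)² ≤ a² + 1.
    nlinarith
  have hint : ∀ i, Integrable (fun x : Fin (N + 1) → ℕ+ =>
      ((harmonic N : ℝ) - (harmonic (occurrences x i - 1) : ℝ)) ^ 2)
      (Measure.pi fun _ : Fin (N + 1) => ν) := fun i =>
    integrable_of_abs_le fun x => abs_le_sum_range
      (F := fun j => ((harmonic N : ℝ) - (harmonic j : ℝ)) ^ 2)
      ((Nat.sub_le _ 1).trans (occurrences_le x i))
  have hle : ∀ i, ∫ x, (harmonicEstimator (N + 1) x - g i x) ^ 2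
      ∂(Measure.pi fun _ : Fin (N + 1) => ν) ≤ (1 / ((N + 1 : ℕ) : ℝ)) ^ 2 *
      (∫ a, binomialExpectation (ν.real {a}) N
        (fun k => ((harmonic N : ℝ) - (harmonic k : ℝ)) ^ 2) ∂ν + 1) := by
    intro i
    refine (integral_mono_of_nonneg (ae_of_all _ fun x => sq_nonneg _)
      (((hint i).add (integrable_const 1)).const_mul _) (ae_of_all _ (hpt i))).trans_eq ?_
    simp only [Pi.add_apply]
    rw [integral_const_mul, integral_add (hint i) (integrable_const 1),
      integral_pi_occurrences ν N i (fun k => ((harmonic N : ℝ) - (harmonic k : ℝ)) ^ 2)]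
    simp
  refine (Finset.sum_le_sum fun i _ => hle i).trans_eq ?_
  rw [Finset.sum_const, Finset.card_univ, Fintype.card_fin, nsmul_eq_mul]
  push_cast
  field_simp

/-! ### Upper bound: variance plus squared bias -/

theorem meanSquaredError_harmonicEstimator_le {C : ℝ} (hC : 0 < C) {p : PMF ℕ+}
    (hp : p ∈ quadraticTailClass C) (N : ℕ) :
    meanSquaredError (harmonicEstimator (N + 1)) p ≤ ENNReal.ofReal
      ((∑' j : ℕ+, 128 * C ^ (3 / 4 : ℝ) * (1 / ((j : ℕ) : ℝ) ^ (3 / 2 : ℝ)) + 1 + 900 * C) /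
        (N + 1)) := by
  set μ := Measure.pi fun _ : Fin (N + 1) => p.toMeasure with hμ
  set f := harmonicEstimator (N + 1) with hf
  have hfb := abs_harmonicEstimator_le (n := N + 1)
  have hfi : Integrable f μ := integrable_of_abs_le hfb
  have hf2 : Integrable (fun x => f x ^ 2) μ :=
    integrable_of_abs_le fun x => by rw [abs_pow]; exact pow_le_pow_left₀ (abs_nonneg _) (hfb x) 2
  set H := shannonEntropy p with hH
  have hf3 : Integrable (fun x => 2 * H * f x) μ := hfi.const_mul _
  have hexp : (fun x => (f x - H) ^ 2) = fun x => f x ^ 2 - 2 * H * f x + H ^ 2 := by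
    funext x; ring
  have hint : Integrable (fun x => (f x - H) ^ 2) μ := by
    rw [hexp]; exact (hf2.sub hf3).add (integrable_const _)
  rw [meanSquaredError, ← ofReal_integral_eq_lintegral_ofReal hint (ae_of_all _ fun x => sq_nonneg _)]
  refine ENNReal.ofReal_le_ofReal ?_
  have hval : ∫ x, (f x - H) ^ 2 ∂μ =
      (∫ x, f x ^ 2 ∂μ - (∫ x, f x ∂μ) ^ 2) + (H - ∫ x, f x ∂μ) ^ 2 := by
    rw [hexp, integral_add (f := fun x => f x ^ 2 - 2 * H * f x) (hf2.sub hf3)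
      (integrable_const _), integral_sub hf2 hf3, integral_const_mul]
    simp
    ring
  have hvar := variance_harmonicEstimator_le p.toMeasure N
  have hbias := abs_shannonEntropy_sub_integral_le hp hC N
  rw [← integral_pi_harmonicEstimator p.toMeasure N] at hbias
  have hsec := integral_binomialExpectation_sq_le hp N
  have hn : (0 : ℝ) < (N : ℝ) + 1 := by positivity
  have hb2 : (H - ∫ x, f x ∂μ) ^ 2 ≤ 900 * C / (N + 1) := by
    rw [← sq_abs]
    refine (pow_le_pow_left₀ (abs_nonneg _) hbias 2).trans_eq ?_
    rw [div_pow, mul_pow, Real.sq_sqrt (by positivity)]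
    field_simp
    norm_num
  rw [hval, add_div]
  refine add_le_add (hvar.trans ?_) hb2
  gcongr

/-! ### The two-point family for the lower bound -/

/-- The probabilities `(6 / π²) j⁻²`, with mass `t` moved from the point `2` to the point `1`. -/
noncomputable def perturbedWeight (t : ℝ) (j : ℕ+) : ℝ :=
  6 / Real.pi ^ 2 / ((j : ℕ) : ℝ) ^ 2 +
    (t * (if j = 1 then 1 else 0) - t * (if j = 2 then 1 else 0))

theorem six_div_pi_sq_pos : 0 < 6 / Real.pi ^ 2 := by positivity

theorem six_div_pi_sq_lt_one : 6 / Real.pi ^ 2 < 1 := by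
  rw [div_lt_one (by positivity)]
  nlinarith [Real.pi_gt_three]

theorem perturbedWeight_one (t : ℝ) : perturbedWeight t 1 = 6 / Real.pi ^ 2 + t := by
  simp [perturbedWeight]

theorem perturbedWeight_two (t : ℝ) : perturbedWeight t 2 = 6 / Real.pi ^ 2 / 4 - t := by
  have h' : ¬ (2 : ℕ+) = 1 := by decide
  simp [perturbedWeight, h']
  ring

theorem perturbedWeight_of_ne (t : ℝ) {j : ℕ+} (h1 : j ≠ 1) (h2 : j ≠ 2) :
    perturbedWeight t j = 6 / Real.pi ^ 2 / ((j : ℕ) : ℝ) ^ 2 := by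
  simp [perturbedWeight, h1, h2]

theorem perturbedWeight_zero (j : ℕ+) :
    perturbedWeight 0 j = 6 / Real.pi ^ 2 / ((j : ℕ) : ℝ) ^ 2 := by
  simp [perturbedWeight]

theorem hasSum_perturbedWeight (t : ℝ) : HasSum (perturbedWeight t) 1 := by
  have h := (PNat.coe_injective.hasSum_iff (f := fun n : ℕ => (1 : ℝ) / (n : ℝ) ^ 2)
    (a := Real.pi ^ 2 / 6) fun n hn => by
      have : n = 0 := by
        by_contra h0
        exact hn ⟨⟨n, Nat.pos_of_ne_zero h0⟩, rfl⟩
      simp [this]).mpr hasSum_zeta_two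
  have h1 := (hasSum_ite_eq (1 : ℕ+) (1 : ℝ)).mul_left t
  have h2 := (hasSum_ite_eq (2 : ℕ+) (1 : ℝ)).mul_left t
  have h3 := (h.mul_left (6 / Real.pi ^ 2)).add (h1.sub h2)
  have hv : 6 / Real.pi ^ 2 * (Real.pi ^ 2 / 6) + (t * 1 - t * 1) = 1 := by
    have := Real.pi_pos.ne'
    field_simp
    ring
  rw [hv] at h3
  refine h3.congr_fun fun j => ?_
  simp only [perturbedWeight, Function.comp_apply, mul_one_div]

theorem perturbedWeight_le {t C : ℝ} (h0 : 0 ≤ t) (hC : 6 / Real.pi ^ 2 + t ≤ C) (j : ℕ+) :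
    perturbedWeight t j ≤ C / ((j : ℕ) : ℝ) ^ 2 := by
  by_cases h1 : j = 1
  · subst h1; simpa [perturbedWeight_one] using hC
  have hD : 6 / Real.pi ^ 2 / ((j : ℕ) : ℝ) ^ 2 ≤ C / ((j : ℕ) : ℝ) ^ 2 := by
    gcongr; linarith
  refine le_trans ?_ hD
  simp only [perturbedWeight, h1, if_false, mul_zero, zero_sub]
  have : 0 ≤ t * (if j = 2 then 1 else 0) := by positivity
  linarith

theorem three_le_of_ne {j : ℕ+} (h1 : j ≠ 1) (h2 : j ≠ 2) : (3 : ℝ) ≤ ((j : ℕ) : ℝ) := by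
  have h1' : (j : ℕ) ≠ 1 := fun h => h1 (PNat.coe_injective h)
  have h2' : (j : ℕ) ≠ 2 := fun h => h2 (PNat.coe_injective h)
  have := j.pos
  exact_mod_cast (by omega : 3 ≤ (j : ℕ))

/-- Only the drop from 2 to 3 is at risk; with D = 6/π², t ≤ D/8 leaves D/4 - t ≥ D/8 > D/9. -/
theorem perturbedWeight_antitone {t : ℝ} (h0 : 0 ≤ t) (ht : t ≤ 6 / Real.pi ^ 2 / 8) :
    Antitone (perturbedWeight t) := by
  intro a b hab
  have hD := six_div_pi_sq_pos
  rcases hab.eq_or_lt with rfl | hlt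
  · rfl
  have hb1 : b ≠ 1 := fun h => by subst h; exact absurd hlt (not_lt_of_ge one_le)
  have hble : perturbedWeight t b ≤ 6 / Real.pi ^ 2 / ((b : ℕ) : ℝ) ^ 2 := by
    simp only [perturbedWeight, hb1, if_false, mul_zero, zero_sub]
    have : 0 ≤ t * (if b = 2 then 1 else 0) := by positivity
    linarith
  by_cases ha1 : a = 1
  · rw [ha1, perturbedWeight_one]
    have hb : (1 : ℝ) ≤ ((b : ℕ) : ℝ) ^ 2 := one_le_pow₀ (by exact_mod_cast one_le)
    have := div_le_self hD.le hb
    linarith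
  by_cases ha2 : a = 2
  · have hb2 : b ≠ 2 := fun h => by rw [ha2, h] at hlt; exact lt_irrefl _ hlt
    rw [ha2, perturbedWeight_two]
    have hb : (9 : ℝ) ≤ ((b : ℕ) : ℝ) ^ 2 := by nlinarith [three_le_of_ne hb1 hb2]
    have : 6 / Real.pi ^ 2 / ((b : ℕ) : ℝ) ^ 2 ≤ 6 / Real.pi ^ 2 / 9 := by gcongr
    linarith
  · rw [perturbedWeight_of_ne t ha1 ha2]
    refine hble.trans ?_
    have : (0 : ℝ) < ((a : ℕ) : ℝ) := by exact_mod_cast a.pos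
    have : ((a : ℕ) : ℝ) ≤ ((b : ℕ) : ℝ) := by exact_mod_cast hab
    gcongr

theorem perturbedWeight_pos {t : ℝ} (h0 : 0 ≤ t) (ht : t ≤ 6 / Real.pi ^ 2 / 8) (j : ℕ+) :
    0 < perturbedWeight t j := by
  have hD := six_div_pi_sq_pos
  by_cases h1 : j = 1
  · rw [h1, perturbedWeight_one]; linarith
  by_cases h2 : j = 2
  · rw [h2, perturbedWeight_two]; linarith
  · rw [perturbedWeight_of_ne t h1 h2]
    have : (0 : ℝ) < ((j : ℕ) : ℝ) := by exact_mod_cast j.pos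
    positivity

/-- The probability mass function with probabilities `perturbedWeight t`. -/
noncomputable def perturbedPMF (t : ℝ) (h : ∀ j, 0 ≤ perturbedWeight t j) : PMF ℕ+ :=
  ⟨fun j => ENNReal.ofReal (perturbedWeight t j), by
    rw [ENNReal.summable.hasSum_iff,
      ← ENNReal.ofReal_tsum_of_nonneg h (hasSum_perturbedWeight t).summable,
      (hasSum_perturbedWeight t).tsum_eq, ENNReal.ofReal_one]⟩

theorem perturbedPMF_apply (t : ℝ) (h : ∀ j, 0 ≤ perturbedWeight t j) (j : ℕ+) :
    perturbedPMF t h j = ENNReal.ofReal (perturbedWeight t j) := rfl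

theorem toReal_perturbedPMF (t : ℝ) (h : ∀ j, 0 ≤ perturbedWeight t j) (j : ℕ+) :
    (perturbedPMF t h j).toReal = perturbedWeight t j := by
  rw [perturbedPMF_apply, ENNReal.toReal_ofReal (h j)]

theorem perturbedPMF_mem {t C : ℝ} (h : ∀ j, 0 ≤ perturbedWeight t j) (h0 : 0 ≤ t)
    (ht : t ≤ 6 / Real.pi ^ 2 / 8) (hC : 6 / Real.pi ^ 2 + t ≤ C) :
    perturbedPMF t h ∈ decreasingQuadraticTailClass C :=
  ⟨fun j => (toReal_perturbedPMF t h j).trans_le (perturbedWeight_le h0 hC j),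
    fun _ _ hab => ENNReal.ofReal_le_ofReal (perturbedWeight_antitone h0 ht hab)⟩

theorem negMulLog_sub_le {x y : ℝ} (hx : 0 < x) (hy : 0 < y) :
    Real.negMulLog y - Real.negMulLog x ≤ (-Real.log x - 1) * (y - x) := by
  have h := Real.log_le_sub_one_of_pos (div_pos hx hy)
  rw [Real.log_div hx.ne' hy.ne'] at h
  have h2 := mul_le_mul_of_nonneg_left h hy.le
  have h3 : y * (x / y - 1) = x - y := by field_simp
  rw [h3] at h2
  simp only [Real.negMulLog]
  nlinarith

theorem hasSum_of_support_one_two {F : ℕ+ → ℝ} (h : ∀ j, j ≠ 1 → j ≠ 2 → F j = 0) :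
    HasSum F (F 1 + F 2) := by
  have h12 : (1 : ℕ+) ≠ 2 := by decide
  rw [← Finset.sum_pair h12]
  refine hasSum_sum_of_ne_finset_zero fun j hj => ?_
  simp only [Finset.mem_insert, Finset.mem_singleton, not_or] at hj
  exact h j hj.1 hj.2

/-- The tangent-line bounds of the concave `Real.negMulLog` at D and D/4, for D = 6/π², add up to -t
log 4, and log 4 ≥ 1. -/
theorem le_shannonEntropy_sub {t C : ℝ} (h : ∀ j, 0 ≤ perturbedWeight t j)
    (h' : ∀ j, 0 ≤ perturbedWeight 0 j) (h0 : 0 ≤ t)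
    (ht : t ≤ 6 / Real.pi ^ 2 / 8) (hC : 6 / Real.pi ^ 2 + t ≤ C) :
    t ≤ shannonEntropy (perturbedPMF 0 h') - shannonEntropy (perturbedPMF t h) := by
  have hD := six_div_pi_sq_pos
  have hs := summable_negMulLog_of_mem_quadraticTailClass (perturbedPMF_mem h h0 ht hC).1
  have hs' := summable_negMulLog_of_mem_quadraticTailClass
    (perturbedPMF_mem (C := C) h' le_rfl (by positivity) (by linarith)).1
  simp only [toReal_perturbedPMF] at hs hs'
  have hd := hs'.hasSum.sub hs.hasSum
  have hd2 := hasSum_of_support_one_two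
    (F := fun j => Real.negMulLog (perturbedWeight 0 j) - Real.negMulLog (perturbedWeight t j))
    fun j h1 h2 => by simp only [perturbedWeight_of_ne _ h1 h2, sub_self]
  have heq := hd.unique hd2
  simp only [shannonEntropy, toReal_perturbedPMF]
  rw [heq, perturbedWeight_one, perturbedWeight_one, perturbedWeight_two, perturbedWeight_two,
    add_zero, sub_zero]
  set D := 6 / Real.pi ^ 2
  have e1 := negMulLog_sub_le hD (show 0 < D + t by linarith)
  have e2 := negMulLog_sub_le (show 0 < D / 4 by linarith) (show 0 < D / 4 - t by linarith)
  have hlog : Real.log (D / 4) = Real.log D - Real.log 4 := Real.log_div hD.ne' (by norm_num)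
  have hlog4 : 1 ≤ Real.log 4 := by
    have : Real.log 4 = 2 * Real.log 2 := by
      rw [show (4 : ℝ) = 2 ^ 2 by norm_num, Real.log_pow]; norm_num
    linarith [Real.log_two_gt_d9]
  rw [hlog] at e2
  nlinarith

/-! ### Le Cam's method and the conclusion -/

/-- Le Cam's two-point bound in terms of a bounded likelihood ratio. -/
theorem le_meanSquaredError_add {n : ℕ} (p q : PMF ℕ+) {r : ℕ+ → ℝ} {B χ : ℝ}
    (hr0 : ∀ j, 0 ≤ r j) (hrB : ∀ j, r j ≤ B) (hq : ∀ j, q j = p j * ENNReal.ofReal (r j))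
    (h1 : ∫ j, r j ∂p.toMeasure = 1) (h2 : ∫ j, r j ^ 2 ∂p.toMeasure = χ) (hχ : χ ^ n ≤ 3 / 2)
    (f : (Fin n → ℕ+) → ℝ) :
    ENNReal.ofReal ((shannonEntropy p - shannonEntropy q) ^ 2 / 8) ≤
      meanSquaredError f p + meanSquaredError f q := by
  set μ := Measure.pi fun _ : Fin n => p.toMeasure with hμ
  set L : (Fin n → ℕ+) → ℝ := fun x => ∏ i, r (x i) with hL
  have hL0 : ∀ x, 0 ≤ L x := fun x => Finset.prod_nonneg fun i _ => hr0 _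
  have hLB : ∀ x, L x ≤ B ^ n := fun x => by
    refine (Finset.prod_le_prod (fun i _ => hr0 _) fun i _ => hrB (x i)).trans_eq ?_
    simp
  have hLi : Integrable L μ := integrable_of_abs_le fun x => by
    rw [abs_of_nonneg (hL0 x)]; exact hLB x
  have hL2i : Integrable (fun x => L x ^ 2) μ := integrable_of_abs_le (B := (B ^ n) ^ 2) fun x => by
    rw [abs_pow, abs_of_nonneg (hL0 x)]; exact pow_le_pow_left₀ (hL0 x) (hLB x) 2
  have hEL : ∫ x, L x ∂μ = 1 := by
    rw [hL, hμ, integral_fintype_prod_eq_prod (fun _ : Fin n => r)]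
    simp [h1]
  have hEL2 : ∫ x, L x ^ 2 ∂μ = χ ^ n := by
    simp only [hL, ← Finset.prod_pow]
    rw [hμ, integral_fintype_prod_eq_prod (fun _ : Fin n => fun j => r j ^ 2)]
    simp [h2]
  have hmin : Integrable (fun x => min 1 (L x)) μ := integrable_of_abs_le (B := 1) fun x => by
    rw [abs_of_nonneg (le_min zero_le_one (hL0 x))]; exact min_le_left _ _
  -- Both 1 and L dominate 2L - L² - 1/4, whose mean is at least 2 - 3/2 - 1/4.
  have hEmin : 1 / 4 ≤ ∫ x, min 1 (L x) ∂μ := by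
    have hi : Integrable (fun x => 2 * L x - L x ^ 2) μ := (hLi.const_mul 2).sub hL2i
    have hle : ∫ x, ((2 * L x - L x ^ 2) - 1 / 4) ∂μ ≤ ∫ x, min 1 (L x) ∂μ :=
      integral_mono (hi.sub (integrable_const _)) hmin fun x =>
        le_min (by nlinarith [sq_nonneg (L x - 1)]) (by nlinarith [sq_nonneg (L x - 1 / 2)])
    rw [integral_sub hi (integrable_const _), integral_sub (hLi.const_mul 2) hL2i,
      integral_const_mul, hEL, hEL2] at hle
    simp at hle
    linarith
  have hsing : ∀ x, (Measure.pi fun _ : Fin n => q.toMeasure) {x} =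
      μ {x} * ENNReal.ofReal (L x) := by
    intro x
    rw [hμ, Measure.pi_singleton, Measure.pi_singleton, hL,
      ENNReal.ofReal_prod_of_nonneg fun i _ => hr0 _, ← Finset.prod_mul_distrib]
    refine Finset.prod_congr rfl fun i _ => ?_
    rw [PMF.toMeasure_apply_singleton _ _ (measurableSet_singleton _),
      PMF.toMeasure_apply_singleton _ _ (measurableSet_singleton _), hq]
  have hqerr : meanSquaredError f q =
      ∫⁻ x, ENNReal.ofReal (L x) * ENNReal.ofReal ((f x - shannonEntropy q) ^ 2) ∂μ := by
    rw [meanSquaredError, lintegral_countable', lintegral_countable']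
    refine tsum_congr fun x => ?_
    rw [hsing]
    ring
  rw [hqerr, meanSquaredError, ← lintegral_add_left Measurable.of_discrete]
  set Δ := shannonEntropy p - shannonEntropy q with hΔ
  calc ENNReal.ofReal (Δ ^ 2 / 8) ≤ ENNReal.ofReal (∫ x, Δ ^ 2 / 2 * min 1 (L x) ∂μ) := by
        refine ENNReal.ofReal_le_ofReal ?_
        rw [integral_const_mul]
        nlinarith [sq_nonneg Δ]
    _ = ∫⁻ x, ENNReal.ofReal (Δ ^ 2 / 2 * min 1 (L x)) ∂μ :=
        ofReal_integral_eq_lintegral_ofReal (hmin.const_mul _) (ae_of_all _ fun x =>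
          mul_nonneg (by positivity) (le_min zero_le_one (hL0 x)))
    _ ≤ _ := by
        refine lintegral_mono fun x => ?_
        simp only
        rw [← ENNReal.ofReal_mul (hL0 x),
          ← ENNReal.ofReal_add (sq_nonneg _) (mul_nonneg (hL0 x) (sq_nonneg _))]
        refine ENNReal.ofReal_le_ofReal ?_
        set u := f x - shannonEntropy p
        set w := f x - shannonEntropy q
        have hw : Δ = w - u := by simp only [hΔ, u, w]; ring
        have hm0 : 0 ≤ min 1 (L x) := le_min zero_le_one (hL0 x)
        have hm1 : min 1 (L x) ≤ 1 := min_le_left _ _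
        have hm2 : min 1 (L x) ≤ L x := min_le_right _ _
        have hsq : Δ ^ 2 / 2 ≤ u ^ 2 + w ^ 2 := by rw [hw]; nlinarith [sq_nonneg (w + u)]
        calc Δ ^ 2 / 2 * min 1 (L x) ≤ (u ^ 2 + w ^ 2) * min 1 (L x) := by gcongr
          _ = min 1 (L x) * u ^ 2 + min 1 (L x) * w ^ 2 := by ring
          _ ≤ 1 * u ^ 2 + L x * w ^ 2 := by gcongr
          _ = u ^ 2 + L x * w ^ 2 := by ring

theorem le_worstCaseRisk {C t : ℝ} {n : ℕ} (h0 : 0 ≤ t) (ht : t ≤ 6 / Real.pi ^ 2 / 8)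
    (hC : 6 / Real.pi ^ 2 + t ≤ C) (hn : n * t ^ 2 ≤ (6 / Real.pi ^ 2 / 8) ^ 2)
    (f : (Fin n → ℕ+) → ℝ) :
    ENNReal.ofReal (t ^ 2 / 16) ≤ worstCaseRisk (decreasingQuadraticTailClass C) f := by
  have hD := six_div_pi_sq_pos
  have hD1 := six_div_pi_sq_lt_one
  have hpos := perturbedWeight_pos h0 ht
  have hpos0 := perturbedWeight_pos (t := 0) le_rfl (by positivity)
  have hmem := perturbedPMF_mem (fun j => (hpos j).le) h0 ht hC
  have hmem0 := perturbedPMF_mem (C := C) (fun j => (hpos0 j).le) le_rfl (by positivity)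
    (by linarith)
  have hH := le_shannonEntropy_sub (fun j => (hpos j).le) (fun j => (hpos0 j).le) h0 ht hC
  set p := perturbedPMF 0 fun j => (hpos0 j).le with hp
  set q := perturbedPMF t fun j => (hpos j).le with hq
  set r : ℕ+ → ℝ := fun j => perturbedWeight t j / perturbedWeight 0 j with hr
  have hr0 : ∀ j, 0 ≤ r j := fun j => (div_pos (hpos j) (hpos0 j)).le
  have hrB : ∀ j, r j ≤ 2 := fun j => by
    have h := perturbedWeight_le h0 (C := 2 * (6 / Real.pi ^ 2)) (by linarith) j
    rw [hr, div_le_iff₀ (hpos0 j), perturbedWeight_zero, ← mul_div_assoc]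
    exact h
  have hmul : ∀ j, perturbedWeight 0 j * r j = perturbedWeight t j := fun j =>
    mul_div_cancel₀ _ (hpos0 j).ne'
  have hE1 : ∫ j, r j ∂p.toMeasure = 1 := by
    rw [integral_toMeasure_eq_tsum p (B := 2) fun j => by rw [abs_of_nonneg (hr0 j)]; exact hrB j]
    simp only [hp, toReal_perturbedPMF, hmul]
    exact (hasSum_perturbedWeight t).tsum_eq
  -- The χ² terms at the points 1 and 2 are t²/D and 4t²/D, where D = 6/π².
  have hE2 : ∫ j, r j ^ 2 ∂p.toMeasure = 1 + 5 * t ^ 2 / (6 / Real.pi ^ 2) := by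
    rw [integral_toMeasure_eq_tsum p (B := 2 ^ 2) fun j => by
      rw [abs_pow, abs_of_nonneg (hr0 j)]; exact pow_le_pow_left₀ (hr0 j) (hrB j) 2]
    simp only [hp, toReal_perturbedPMF]
    have hs := hasSum_of_support_one_two
      (F := fun j => perturbedWeight 0 j * r j ^ 2 - perturbedWeight t j) fun j h1 h2 => by
        have h3 : perturbedWeight t j = perturbedWeight 0 j := by
          simp only [perturbedWeight_of_ne _ h1 h2]
        simp only [hr, h3, div_self (hpos0 j).ne', one_pow, mul_one, sub_self]
    have hs2 := hs.add (hasSum_perturbedWeight t)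
    simp only [sub_add_cancel] at hs2
    rw [hs2.tsum_eq]
    simp only [hr, perturbedWeight_one, perturbedWeight_two, add_zero, sub_zero]
    field_simp
    ring
  have hχ : (1 + 5 * t ^ 2 / (6 / Real.pi ^ 2)) ^ n ≤ 3 / 2 := by
    have hx : (n : ℝ) * (5 * t ^ 2 / (6 / Real.pi ^ 2)) ≤ 1 / 5 := by
      rw [← mul_div_assoc, div_le_iff₀ hD]
      nlinarith
    have he := Real.exp_bound_div_one_sub_of_interval (x := 1 / 5) (by norm_num) (by norm_num)
    calc (1 + 5 * t ^ 2 / (6 / Real.pi ^ 2)) ^ n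
        ≤ Real.exp (5 * t ^ 2 / (6 / Real.pi ^ 2)) ^ n := by
          gcongr
          rw [add_comm]
          exact Real.add_one_le_exp _
      _ = Real.exp (n * (5 * t ^ 2 / (6 / Real.pi ^ 2))) := (Real.exp_nat_mul _ n).symm
      _ ≤ Real.exp (1 / 5) := Real.exp_le_exp.mpr hx
      _ ≤ 3 / 2 := he.trans (by norm_num)
  have hratio : ∀ j, q j = p j * ENNReal.ofReal (r j) := fun j => by
    rw [hp, hq, perturbedPMF_apply, perturbedPMF_apply, ← ENNReal.ofReal_mul (hpos0 j).le, hmul]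
  have hmain := le_meanSquaredError_add p q hr0 hrB hratio hE1 hE2 hχ f
  have hsup : meanSquaredError f p + meanSquaredError f q ≤
      2 * worstCaseRisk (decreasingQuadraticTailClass C) f := by
    rw [two_mul]
    exact add_le_add (le_iSup₂_of_le p hmem0 le_rfl) (le_iSup₂_of_le q hmem le_rfl)
  have hfin : 2 * ENNReal.ofReal (t ^ 2 / 16) ≤
      2 * worstCaseRisk (decreasingQuadraticTailClass C) f := by
    refine le_trans ?_ (hmain.trans hsup)
    rw [← ENNReal.ofReal_ofNat, ← ENNReal.ofReal_mul (by norm_num)]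
    refine ENNReal.ofReal_le_ofReal ?_
    nlinarith
  exact (ENNReal.mul_le_mul_iff_right (by norm_num) (by norm_num)).mp hfin

theorem worstCaseRisk_mono {P Q : Set (PMF ℕ+)} (h : P ⊆ Q) {n : ℕ} (f : (Fin n → ℕ+) → ℝ) :
    worstCaseRisk P f ≤ worstCaseRisk Q f :=
  biSup_mono h

theorem minimaxRisk_mono {P Q : Set (PMF ℕ+)} (h : P ⊆ Q) (n : ℕ) :
    minimaxRisk P n ≤ minimaxRisk Q n :=
  iInf_mono fun f => worstCaseRisk_mono h f

theorem theorem1 (C : ℝ) (hC : 6 / Real.pi ^ 2 < C) :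
    ∃ c K : ℝ, 0 < c ∧ 0 < K ∧
      ∀ P ∈ ({quadraticTailClass C, decreasingQuadraticTailClass C} : Set (Set (PMF ℕ+))),
        ∀ n : ℕ, 1 ≤ n →
          ENNReal.ofReal (c / n) ≤ minimaxRisk P n ∧
          minimaxRisk P n ≤ ENNReal.ofReal (K / n) ∧
          worstCaseRisk P (harmonicEstimator n) ≤ ENNReal.ofReal (K / n) := by
  have hD := six_div_pi_sq_pos
  have hC0 : 0 < C := hD.trans hC
  -- The first bound keeps p_1 ≤ C, the second keeps the weights positive and nonincreasing; t =
  -- τ/√n then gives n t² = τ².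
  set τ := min (C - 6 / Real.pi ^ 2) (6 / Real.pi ^ 2 / 8) with hτ
  have hτ0 : 0 < τ := lt_min (by linarith) (by positivity)
  have hτ1 : τ ≤ C - 6 / Real.pi ^ 2 := min_le_left _ _
  have hτ2 : τ ≤ 6 / Real.pi ^ 2 / 8 := min_le_right _ _
  have hsub : decreasingQuadraticTailClass C ⊆ quadraticTailClass C := fun p hp => hp.1
  refine ⟨τ ^ 2 / 16,
    ∑' j : ℕ+, 128 * C ^ (3 / 4 : ℝ) * (1 / ((j : ℕ) : ℝ) ^ (3 / 2 : ℝ)) + 1 + 900 * C,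
    by positivity, ?_, fun P hP n hn => ?_⟩
  · have : 0 ≤ ∑' j : ℕ+, 128 * C ^ (3 / 4 : ℝ) * (1 / ((j : ℕ) : ℝ) ^ (3 / 2 : ℝ)) :=
      tsum_nonneg fun j => by positivity
    positivity
  -- Upper bounds come from the large class and lower bounds from the small one, hence common
  -- constants.
  have hPsub : P ⊆ quadraticTailClass C ∧ decreasingQuadraticTailClass C ⊆ P := by
    rcases hP with rfl | rfl
    · exact ⟨subset_rfl, hsub⟩
    · exact ⟨hsub, subset_rfl⟩
  have hn0 : (0 : ℝ) < n := by exact_mod_cast hn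
  have hupper : worstCaseRisk P (harmonicEstimator n) ≤ ENNReal.ofReal
      ((∑' j : ℕ+, 128 * C ^ (3 / 4 : ℝ) * (1 / ((j : ℕ) : ℝ) ^ (3 / 2 : ℝ)) + 1 + 900 * C) /
        n) := by
    refine iSup₂_le fun p hp => ?_
    obtain ⟨N, rfl⟩ := Nat.exists_eq_add_of_le' hn
    have h := meanSquaredError_harmonicEstimator_le hC0 (hPsub.1 hp) N
    push_cast
    exact h
  refine ⟨le_trans (le_iInf fun f => ?_) (minimaxRisk_mono hPsub.2 n),
    (iInf_le _ _).trans hupper, hupper⟩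
  have hsq1 : 1 ≤ Real.sqrt n := Real.one_le_sqrt.mpr (by exact_mod_cast hn)
  have hle : τ / Real.sqrt n ≤ τ := div_le_self hτ0.le hsq1
  have hsq : (τ / Real.sqrt n) ^ 2 = τ ^ 2 / n := by rw [div_pow, Real.sq_sqrt hn0.le]
  have h := le_worstCaseRisk (C := C) (t := τ / Real.sqrt n) (by positivity) (hle.trans hτ2)
    (by linarith) (by
      rw [hsq, mul_div_cancel₀ _ hn0.ne']
      exact pow_le_pow_left₀ hτ0.le hτ2 2) f
  rw [hsq] at h
  rwa [div_right_comm]
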